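/- Consider the differential equation $y'''(x)-x^2y''(x)-xy'(x)+y(x)=0$ for real-valued functions of a real variable. The following hold. (a) $y_0(x)=x$ is a solution on $\mathbb R$. There is exactly one solution $y_1$ on $\mathbb R$ of the form $y_1(x)=\sum_{r\ge 0}c_rx^{3r}$ and exactly one solution $y_2$ on $\mathbb R$ of the form $y_2(x)=x^2\sum_{r\ge 0}d_rx^{3r}$, with real coefficients, $c_0=d_0=1$, and series convergent for all $x\in\mathbb R$. (b) There is exactly one solution $y_{\infty 2}$ on $\mathbb R$ such that $y_{\infty 2}(x)\sim x^{-1}$ as $x\to+\infty$, that is, $x\,y_{\infty 2}(x)\to 1$. (c) For all $x\in\mathbb R$, $$y_{\infty 2}(x)=2\cdot 3^{-1/3}\,\Gamma\!\left(\tfrac23\right)y_1(x)+y_2(x)-2\cdot 3^{-2/3}\,\Gamma\!\left(\tfrac23\right)^2y_0(x).$$ Moreover, for every $X\in\mathbb R$, any solution $y$ on $(X,\infty)$ with $y(x)\sim x^{-1}$ as $x\to+\infty$ is given on $(X,\infty)$ by the right-hand side of this formula. (d) In particular $y_{\infty 2}(0)=2\cdot 3^{-1/3}\,\Gamma\!\left(\tfrac23\right)$,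 and this number equals $1.87778588$ to eight decimal places: $|y_{\infty 2}(0)-1.87778588|<5\cdot 10^{-9}$. -/

import Mathlib

open Filter Asymptotics

/-- `y` is a (real) solution of `y''' - x² y'' - x y' + y = 0` on the open set `s`: it is three
times differentiable there, with derivatives `y₁ = y'`, `y₂ = y''`, `y₃ = y'''`, and it satisfies
the equation at every point of `s`. -/
def IsSolutionOn (s : Set ℝ) (y : ℝ → ℝ) : Prop :=
  ∃ y₁ y₂ y₃ : ℝ → ℝ, ∀ x ∈ s,
    HasDerivAt y (y₁ x) x ∧ HasDerivAt y₁ (y₂ x) x ∧ HasDerivAt y₂ (y₃ x) x ∧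
      y₃ x - x ^ 2 * y₂ x - x * y₁ x + y x = 0

/-- `y` is a solution on `ℝ` of the form `∑ c_r x^{3r}`, convergent for all real `x`,
with `c₀ = 1`. -/
def IsSeriesSolutionOne (y : ℝ → ℝ) : Prop :=
  IsSolutionOn Set.univ y ∧
    ∃ c : ℕ → ℝ, c 0 = 1 ∧ ∀ x : ℝ, HasSum (fun r : ℕ => c r * x ^ (3 * r)) (y x)

/-- `y` is a solution on `ℝ` of the form `x² ∑ d_r x^{3r}`, convergent for all real `x`,
with `d₀ = 1`. -/
def IsSeriesSolutionTwo (y : ℝ → ℝ) : Prop :=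
  IsSolutionOn Set.univ y ∧
    ∃ d : ℕ → ℝ, d 0 = 1 ∧ ∀ x : ℝ, HasSum (fun r : ℕ => x ^ 2 * (d r * x ^ (3 * r))) (y x)

/-- `y` is a solution on `ℝ` with `y(x) ~ x⁻¹` as `x → +∞`. -/
def IsDecayingSolution (y : ℝ → ℝ) : Prop :=
  IsSolutionOn Set.univ y ∧ y ~[atTop] (fun x : ℝ => x⁻¹)

/-! Put `w = x y' - y`, so that `w' = x y''`. The equation says that `C = x w - y''` is constant,
hence `w' = x² w - C x`, which integrates to `w = exp (x³/3) (D + C K)` with `K = cubicTail`, the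
antiderivative of `-x exp (-x³/3)` that vanishes at `+∞` (`IsSolutionOn.exists_first_integrals`).
Everything else is read off from the pair `(C, D)`.

The decaying solution has `D = 0` and `C = -2`: then `w = -2 T` with `T = scaledTail`, and `y'' = 2
(1 - x T)`. Its slope must vanish at infinity, which forces `y'(0) = -2 ∫₀^∞ (1 - s T s) ds`. The
crux is `integral_one_sub_mul_scaledTail`, which evaluates this integral as `3^(-2/3) Γ(2/3)²` by
writing the integrand as an integral over `(0, 1)`, exchanging the order of integration and
recognising a Beta integral. L'Hôpital's rule then gives `x y → 1`.

For uniqueness (`IsSolutionOn.eq_zero_of_tendsto`), a solution that is `o(1/x)` cannot have `D ≠ 0`,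
because of exponential growth, nor `C ≠ 0`, since it would then be a nonzero multiple of the
decaying solution; what remains is a multiple of `x`, which must be zero. The connection formula
compares initial values at the origin, which determine a solution. -/

open MeasureTheory

/-! ### Power series solutions at the origin -/

theorem HasSum.exists_hasDerivAt_powerSeries {a : ℕ → ℝ} {f : ℝ → ℝ}
    (h : ∀ x, HasSum (fun n => a n * x ^ n) (f x)) :
    ∃ f' : ℝ → ℝ, ∀ x, HasDerivAt f (f' x) x ∧
      HasSum (fun n : ℕ => ((n + 1) * a (n + 1)) * x ^ n) (f' x) := by
  have key : ∀ x : ℝ, HasDerivAt f (∑' n : ℕ, a n * (n * x ^ (n - 1))) x ∧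
      Summable (fun n : ℕ => a n * (n * x ^ (n - 1))) := by
    intro x
    -- On the ball of radius `R` the differentiated series is dominated by the original one at `2 *
    -- R`, since `n ≤ 2 ^ n`; `1 ≤ R` absorbs the drop from `n` to `n - 1` in the exponent.
    set R : ℝ := |x| + 1 with hR
    have hR1 : 1 ≤ R := by simp [hR]
    have hu : Summable (fun n => |a n * (2 * R) ^ n|) := (h (2 * R)).summable.abs
    have hb : ∀ (n : ℕ) (y : ℝ), y ∈ Metric.ball (0 : ℝ) R →
        ‖a n * (n * y ^ (n - 1))‖ ≤ |a n * (2 * R) ^ n| := by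
      intro n y hy
      have hy' : |y| ≤ R := by
        simpa using (Metric.mem_ball.1 hy).le
      have hR0 : 0 ≤ R := by linarith
      rw [Real.norm_eq_abs, abs_mul, abs_mul, abs_mul, abs_pow, abs_pow, Nat.abs_cast,
        abs_of_nonneg (by positivity : 0 ≤ 2 * R), mul_pow]
      have h1 : (n : ℝ) ≤ 2 ^ n := by exact_mod_cast Nat.lt_two_pow_self.le
      have h2 : |y| ^ (n - 1) ≤ R ^ n :=
        (pow_le_pow_left₀ (abs_nonneg _) hy' _).trans (pow_le_pow_right₀ hR1 (Nat.sub_le _ _))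
      gcongr
    have hx : x ∈ Metric.ball (0 : ℝ) R := by simp [hR]
    have hd := hasDerivAt_tsum_of_isPreconnected hu Metric.isOpen_ball
      (convex_ball (0 : ℝ) R).isPreconnected
      (fun n y _ => (hasDerivAt_pow n y).const_mul (a n)) hb hx (h x).summable hx
    have hf : f = fun z => ∑' n, a n * z ^ n := funext fun z => (h z).tsum_eq.symm
    rw [← hf] at hd
    exact ⟨hd, Summable.of_norm_bounded hu fun n => hb n x hx⟩
  refine ⟨_, fun x => ⟨(key x).1, ?_⟩⟩
  have h1 := (hasSum_nat_add_iff' 1).2 (key x).2.hasSum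
  simp only [Finset.range_one, Finset.sum_singleton, Nat.cast_zero, zero_mul, mul_zero,
    sub_zero] at h1
  refine h1.congr_fun fun n => ?_
  push_cast
  ring

theorem HasSum.natCast_mul_powerSeries {a : ℕ → ℝ} {x s : ℝ}
    (h : HasSum (fun n : ℕ => ((n + 1) * a (n + 1)) * x ^ n) s) :
    HasSum (fun n : ℕ => (n * a n) * x ^ n) (x * s) := by
  rw [← hasSum_nat_add_iff' 1]
  simp only [Finset.range_one, Finset.sum_singleton, Nat.cast_zero, zero_mul, sub_zero]
  refine (h.mul_left x).congr_fun fun n => ?_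
  push_cast
  ring

theorem HasSum.powerSeries_zero {a : ℕ → ℝ} {s : ℝ}
    (h : HasSum (fun n => a n * (0 : ℝ) ^ n) s) : s = a 0 := by
  refine h.unique ?_
  simpa using hasSum_single (f := fun n => a n * (0 : ℝ) ^ n) 0 (fun n hn => by simp [hn])

/-- A convergent power series satisfying the recurrence of the equation is a solution. -/
theorem isSolutionOn_univ_of_hasSum {a : ℕ → ℝ} {f : ℝ → ℝ}
    (h : ∀ x, HasSum (fun n => a n * x ^ n) (f x))
    (ha : ∀ n : ℕ, ((n : ℝ) + 3) * (n + 2) * a (n + 3) = (n - 1) * a n) :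
    IsSolutionOn Set.univ f := by
  obtain ⟨f₁, h₁⟩ := HasSum.exists_hasDerivAt_powerSeries h
  obtain ⟨f₂, h₂⟩ := HasSum.exists_hasDerivAt_powerSeries fun x => (h₁ x).2
  obtain ⟨f₃, h₃⟩ := HasSum.exists_hasDerivAt_powerSeries fun x => (h₂ x).2
  refine ⟨f₁, f₂, f₃, fun x _ => ⟨(h₁ x).1, (h₂ x).1, (h₃ x).1, ?_⟩⟩
  have e₁ := (h₁ x).2.natCast_mul_powerSeries
  -- Each multiplication by `x` shifts the index once; between the two, the coefficient `n (n + 1) a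
  -- (n + 1)` is reread as that of the derivative of `∑ (n - 1) a n xⁿ`.
  have e₂ : HasSum (fun n : ℕ => (n * ((n - 1) * a n)) * x ^ n) (x * (x * f₂ x)) := by
    refine HasSum.natCast_mul_powerSeries (a := fun n : ℕ => ((n : ℝ) - 1) * a n) ?_
    refine (HasSum.natCast_mul_powerSeries (a := fun n : ℕ => ((n : ℝ) + 1) * a (n + 1))
      (h₂ x).2).congr_fun fun n => ?_
    push_cast
    ring
  have e := (((h₃ x).2.sub e₂).sub e₁).add (h x)
  have e0 : HasSum (fun _ : ℕ => (0 : ℝ)) (f₃ x - x * (x * f₂ x) - x * f₁ x + f x) := by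
    refine e.congr_fun fun n => ?_
    have := ha n
    push_cast
    have h3 : n + 1 + 1 + 1 = n + 3 := rfl
    rw [h3]
    -- The coefficient relation has the common factor `n + 1`, because `n (n - 1) + n - 1 = (n + 1)
    -- (n - 1)`.
    linear_combination (-(n + 1) * x ^ n) * this
  linear_combination e0.unique hasSum_zero

/-- The initial values at the origin of a solution given by a power series. -/
theorem IsSolutionOn.initial_values_of_hasSum {a : ℕ → ℝ} {f f₁ f₂ : ℝ → ℝ}
    (h : ∀ x, HasSum (fun n => a n * x ^ n) (f x))
    (hf₁ : ∀ x, HasDerivAt f (f₁ x) x) (hf₂ : ∀ x, HasDerivAt f₁ (f₂ x) x) :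
    f 0 = a 0 ∧ f₁ 0 = a 1 ∧ f₂ 0 = 2 * a 2 := by
  obtain ⟨g₁, h₁⟩ := HasSum.exists_hasDerivAt_powerSeries h
  obtain ⟨g₂, h₂⟩ := HasSum.exists_hasDerivAt_powerSeries fun x => (h₁ x).2
  have e₁ : f₁ = g₁ := funext fun x => (hf₁ x).unique (h₁ x).1
  have e₂ : f₂ = g₂ := funext fun x => (hf₂ x).unique (e₁ ▸ (h₂ x).1)
  refine ⟨(h 0).powerSeries_zero, ?_, ?_⟩
  · rw [e₁, (h₁ 0).2.powerSeries_zero]; simp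
  · rw [e₂, (h₂ 0).2.powerSeries_zero]; norm_num

/-- The coefficients of `∑ c_r x^{3r+k}` as a series in all powers of `x`. -/
noncomputable def sparseCoeff (k : ℕ) (c : ℕ → ℝ) (n : ℕ) : ℝ :=
  if n % 3 = k then c (n / 3) else 0

theorem hasSum_sparseCoeff {k : ℕ} (hk : k < 3) {c : ℕ → ℝ} {x s : ℝ}
    (h : HasSum (fun r : ℕ => x ^ k * (c r * x ^ (3 * r))) s) :
    HasSum (fun n => sparseCoeff k c n * x ^ n) s := by
  have hi : Function.Injective (fun r : ℕ => 3 * r + k) := fun a b hab => by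
    simpa using hab
  rw [← hi.hasSum_iff]
  · refine h.congr_fun fun r => ?_
    have h1 : (3 * r + k) % 3 = k := by omega
    have h2 : (3 * r + k) / 3 = r := by omega
    simp only [Function.comp, sparseCoeff, h1, h2, if_true]
    ring
  · intro n hn
    have : n % 3 ≠ k := fun hm => hn ⟨n / 3, by simp only; omega⟩
    simp [sparseCoeff, this]

/-- The ratio bound gives `|c r| ≤ 1 / r!`, so the exponential series dominates. -/
theorem summable_mul_pow_of_recurrence {c : ℕ → ℝ} {q : ℕ → ℝ} (h0 : c 0 = 1)
    (hc : ∀ r, c (r + 1) = q r * c r) (hq : ∀ r : ℕ, |q r| ≤ 1 / (r + 1)) (t : ℝ) :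
    Summable (fun r => c r * t ^ r) := by
  have hb : ∀ r, |c r| ≤ 1 / r.factorial := by
    intro r
    induction r with
    | zero => simp [h0]
    | succ r ih =>
      rw [hc, abs_mul, Nat.factorial_succ]
      calc |q r| * |c r| ≤ 1 / (r + 1) * (1 / r.factorial) := by
            gcongr
            exact hq r
        _ = _ := by push_cast; field_simp
  refine Summable.of_norm_bounded (Real.summable_pow_div_factorial |t|) fun r => ?_
  rw [Real.norm_eq_abs, abs_mul, abs_pow]
  calc |c r| * |t| ^ r ≤ 1 / r.factorial * |t| ^ r := by gcongr; exact hb r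
    _ = _ := by ring

theorem exists_isSeriesSolution {k : ℕ} (hk : k = 0 ∨ k = 2) :
    ∃ y : ℝ → ℝ, IsSolutionOn Set.univ y ∧
      ∃ c : ℕ → ℝ, c 0 = 1 ∧ ∀ x : ℝ, HasSum (fun r : ℕ => x ^ k * (c r * x ^ (3 * r))) (y x) := by
  -- The recurrence between `a n` and `a (n + 3)` at `n = 3 * r + k`, solved for the ratio.
  set q : ℕ → ℝ := fun r => (3 * r + k - 1) / ((3 * r + k + 3) * (3 * r + k + 2)) with hq
  set c : ℕ → ℝ := fun r => Nat.rec 1 (fun r z => q r * z) r with hc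
  have hc1 : ∀ r, c (r + 1) = q r * c r := fun r => rfl
  have hqb : ∀ r : ℕ, |q r| ≤ 1 / (r + 1) := by
    intro r
    have hr : (0 : ℝ) ≤ r := r.cast_nonneg
    have hk0 : (0 : ℝ) ≤ k := k.cast_nonneg
    simp only [hq]
    rw [abs_div, abs_of_pos (by positivity : (0 : ℝ) < (3 * r + k + 3) * (3 * r + k + 2)),
      div_le_div_iff₀ (by positivity) (by positivity)]
    have : |(3 * r + k - 1 : ℝ)| ≤ 3 * r + k + 2 := abs_le.2 ⟨by linarith, by linarith⟩
    nlinarith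
  have hs : ∀ x : ℝ, Summable (fun r : ℕ => x ^ k * (c r * x ^ (3 * r))) := by
    intro x
    refine Summable.mul_left _ ?_
    simpa only [pow_mul] using summable_mul_pow_of_recurrence rfl hc1 hqb (x ^ 3)
  refine ⟨fun x => ∑' r : ℕ, x ^ k * (c r * x ^ (3 * r)), ?_, c, rfl, fun x => (hs x).hasSum⟩
  have hk3 : k < 3 := by omega
  refine isSolutionOn_univ_of_hasSum (fun x => hasSum_sparseCoeff hk3 (hs x).hasSum) fun n => ?_
  unfold sparseCoeff
  by_cases hn : n % 3 = k
  · obtain ⟨r, rfl⟩ : ∃ r, n = 3 * r + k := ⟨n / 3, by omega⟩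
    have h1 : (3 * r + k) % 3 = k := by omega
    have h2 : (3 * r + k) / 3 = r := by omega
    have h3 : (3 * r + k + 3) % 3 = k := by omega
    have h4 : (3 * r + k + 3) / 3 = r + 1 := by omega
    simp only [h1, h2, h3, h4, if_true, hc1, hq]
    push_cast
    field_simp
  · have h3 : (n + 3) % 3 ≠ k := by omega
    simp [hn]

theorem IsSeriesSolutionOne.initial_values {f f₁ f₂ : ℝ → ℝ} (h : IsSeriesSolutionOne f)
    (hf₁ : ∀ x, HasDerivAt f (f₁ x) x) (hf₂ : ∀ x, HasDerivAt f₁ (f₂ x) x) :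
    f 0 = 1 ∧ f₁ 0 = 0 ∧ f₂ 0 = 0 := by
  obtain ⟨-, c, hc, hs⟩ := h
  have := IsSolutionOn.initial_values_of_hasSum
    (fun x => hasSum_sparseCoeff (k := 0) (by norm_num) (by simpa using hs x)) hf₁ hf₂
  simpa [sparseCoeff, hc] using this

theorem IsSeriesSolutionTwo.initial_values {f f₁ f₂ : ℝ → ℝ} (h : IsSeriesSolutionTwo f)
    (hf₁ : ∀ x, HasDerivAt f (f₁ x) x) (hf₂ : ∀ x, HasDerivAt f₁ (f₂ x) x) :
    f 0 = 0 ∧ f₁ 0 = 0 ∧ f₂ 0 = 2 := by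
  obtain ⟨-, c, hc, hs⟩ := h
  have := IsSolutionOn.initial_values_of_hasSum
    (fun x => hasSum_sparseCoeff (k := 2) (by norm_num) (hs x)) hf₁ hf₂
  simpa [sparseCoeff, hc] using this

/-! ### Linearity, first integrals and initial values -/

theorem IsSolutionOn.mono {s t : Set ℝ} {y : ℝ → ℝ} (h : IsSolutionOn t y) (hst : s ⊆ t) :
    IsSolutionOn s y := by
  obtain ⟨y₁, y₂, y₃, h⟩ := h
  exact ⟨y₁, y₂, y₃, fun x hx => h x (hst hx)⟩

theorem IsSolutionOn.add {s : Set ℝ} {y z : ℝ → ℝ} (hy : IsSolutionOn s y)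
    (hz : IsSolutionOn s z) : IsSolutionOn s (fun x => y x + z x) := by
  obtain ⟨y₁, y₂, y₃, hy⟩ := hy
  obtain ⟨z₁, z₂, z₃, hz⟩ := hz
  refine ⟨fun x => y₁ x + z₁ x, fun x => y₂ x + z₂ x, fun x => y₃ x + z₃ x, fun x hx => ?_⟩
  obtain ⟨a, b, c, d⟩ := hy x hx
  obtain ⟨a', b', c', d'⟩ := hz x hx
  exact ⟨a.add a', b.add b', c.add c', by linear_combination d + d'⟩

theorem IsSolutionOn.const_mul {s : Set ℝ} {y : ℝ → ℝ} (hy : IsSolutionOn s y) (k : ℝ) :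
    IsSolutionOn s (fun x => k * y x) := by
  obtain ⟨y₁, y₂, y₃, hy⟩ := hy
  refine ⟨fun x => k * y₁ x, fun x => k * y₂ x, fun x => k * y₃ x, fun x hx => ?_⟩
  obtain ⟨a, b, c, d⟩ := hy x hx
  exact ⟨a.const_mul k, b.const_mul k, c.const_mul k, by linear_combination k * d⟩

theorem IsSolutionOn.sub {s : Set ℝ} {y z : ℝ → ℝ} (hy : IsSolutionOn s y)
    (hz : IsSolutionOn s z) : IsSolutionOn s (fun x => y x - z x) := by
  simpa [sub_eq_add_neg] using hy.add (hz.const_mul (-1))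

theorem isSolutionOn_id : IsSolutionOn Set.univ (fun x : ℝ => x) :=
  ⟨fun _ => 1, fun _ => 0, fun _ => 0, fun x _ =>
    ⟨hasDerivAt_id x, hasDerivAt_const x 1, hasDerivAt_const x 0, by ring⟩⟩

theorem exists_const_of_hasDerivAt_zero {s : Set ℝ} (hs : IsOpen s) (hs' : IsPreconnected s)
    {f : ℝ → ℝ} (hf : ∀ x ∈ s, HasDerivAt f 0 x) : ∃ a, ∀ x ∈ s, f x = a :=
  hs.exists_is_const_of_deriv_eq_zero hs'
    (fun x hx => (hf x hx).differentiableAt.differentiableWithinAt) (fun x hx => (hf x hx).deriv)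

theorem hasDerivAt_exp_cube (x : ℝ) :
    HasDerivAt (fun x : ℝ => Real.exp (x ^ 3 / 3)) (x ^ 2 * Real.exp (x ^ 3 / 3)) x := by
  have h : HasDerivAt (fun x : ℝ => x ^ 3 / 3) (x ^ 2) x := by
    refine ((hasDerivAt_pow 3 x).div_const 3).congr_deriv ?_
    push_cast
    ring
  exact h.exp.congr_deriv (mul_comm _ _)

theorem hasDerivAt_exp_neg_cube (x : ℝ) :
    HasDerivAt (fun x : ℝ => Real.exp (-(x ^ 3 / 3))) (-x ^ 2 * Real.exp (-(x ^ 3 / 3))) x := by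
  have h : HasDerivAt (fun x : ℝ => -(x ^ 3 / 3)) (-x ^ 2) x := by
    refine ((hasDerivAt_pow 3 x).div_const 3).neg.congr_deriv ?_
    push_cast
    ring
  exact h.exp.congr_deriv (mul_comm _ _)

theorem exp_cube_mul_exp_neg_cube (x : ℝ) :
    Real.exp (x ^ 3 / 3) * Real.exp (-(x ^ 3 / 3)) = 1 := by
  rw [← Real.exp_add, add_neg_cancel, Real.exp_zero]

/-- First integrals of the equation. -/
theorem IsSolutionOn.exists_first_integrals {s : Set ℝ} (hs : IsOpen s) (hs' : IsPreconnected s)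
    {y K : ℝ → ℝ} (hK : ∀ x, HasDerivAt K (-x * Real.exp (-(x ^ 3 / 3))) x)
    (hy : IsSolutionOn s y) :
    ∃ (C D : ℝ) (y₁ y₂ : ℝ → ℝ), ∀ x ∈ s,
      HasDerivAt y (y₁ x) x ∧ HasDerivAt y₁ (y₂ x) x ∧
      y₂ x = x * (x * y₁ x - y x) - C ∧
      x * y₁ x - y x = Real.exp (x ^ 3 / 3) * (D + C * K x) := by
  obtain ⟨y₁, y₂, y₃, h⟩ := hy
  obtain ⟨C, hC⟩ : ∃ C, ∀ x ∈ s, x * (x * y₁ x - y x) - y₂ x = C := by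
    refine exists_const_of_hasDerivAt_zero hs hs' (fun x hx => ?_)
    obtain ⟨a, b, c, d⟩ := h x hx
    refine (((hasDerivAt_id' x).mul (((hasDerivAt_id' x).mul b).sub a)).sub c).congr_deriv ?_
    simp only [Pi.mul_apply, Pi.sub_apply]
    linear_combination -d
  -- With `C` constant, `w = x y' - y` satisfies `w' = x² w - C x`; the integrating factor is `exp
  -- (-x³/3)`.
  obtain ⟨D, hD⟩ : ∃ D, ∀ x ∈ s,
      Real.exp (-(x ^ 3 / 3)) * (x * y₁ x - y x) - C * K x = D := by
    refine exists_const_of_hasDerivAt_zero hs hs' (fun x hx => ?_)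
    obtain ⟨a, b, -, -⟩ := h x hx
    refine (((hasDerivAt_exp_neg_cube x).mul (((hasDerivAt_id' x).mul b).sub a)).sub
      ((hK x).const_mul C)).congr_deriv ?_
    simp only [Pi.mul_apply, Pi.sub_apply]
    linear_combination -x * Real.exp (-(x ^ 3 / 3)) * hC x hx
  refine ⟨C, D, y₁, y₂, fun x hx => ⟨(h x hx).1, (h x hx).2.1, ?_, ?_⟩⟩
  · linear_combination -hC x hx
  · linear_combination Real.exp (x ^ 3 / 3) * hD x hx -
      (x * y₁ x - y x) * exp_cube_mul_exp_neg_cube x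

/-- The antiderivative of `-x * exp (-x³ / 3)` that vanishes at infinity. -/
noncomputable def cubicTail (x : ℝ) : ℝ :=
  (3 : ℝ) ^ (-(1 / 3) : ℝ) * Real.Gamma (2 / 3) - ∫ s in (0 : ℝ)..x, s * Real.exp (-(s ^ 3 / 3))

theorem hasDerivAt_cubicTail (x : ℝ) :
    HasDerivAt cubicTail (-x * Real.exp (-(x ^ 3 / 3))) x := by
  have hc : Continuous fun s : ℝ => s * Real.exp (-(s ^ 3 / 3)) := by fun_prop
  refine ((hc.integral_hasStrictDerivAt 0 x).hasDerivAt.const_sub _).congr_deriv ?_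
  ring

theorem cubicTail_zero :
    cubicTail 0 = (3 : ℝ) ^ (-(1 / 3) : ℝ) * Real.Gamma (2 / 3) := by
  simp [cubicTail]

/-- A solution on `ℝ` with vanishing initial values at the origin is zero. -/
theorem IsSolutionOn.eq_zero_of_initial_values {z z₁ z₂ : ℝ → ℝ} (hz : IsSolutionOn Set.univ z)
    (h₁ : ∀ x, HasDerivAt z (z₁ x) x) (h₂ : ∀ x, HasDerivAt z₁ (z₂ x) x)
    (i₀ : z 0 = 0) (i₁ : z₁ 0 = 0) (i₂ : z₂ 0 = 0) (x : ℝ) : z x = 0 := by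
  obtain ⟨C, D, y₁, y₂, h⟩ := hz.exists_first_integrals isOpen_univ isPreconnected_univ
    hasDerivAt_cubicTail
  obtain rfl : y₁ = z₁ := funext fun x => (h x trivial).1.unique (h₁ x)
  obtain rfl : y₂ = z₂ := funext fun x => (h x trivial).2.1.unique (h₂ x)
  have hC : C = 0 := by linear_combination (h 0 trivial).2.2.1 - i₂
  have hD : D = 0 := by
    have := (h 0 trivial).2.2.2
    simp only [i₀, hC] at this
    simpa using this.symm
  have hw : ∀ x, x * y₁ x - z x = 0 := fun x => by rw [(h x trivial).2.2.2, hC, hD]; ring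
  have hy₂ : ∀ x, y₂ x = 0 := fun x => by rw [(h x trivial).2.2.1, hC, hw]; ring
  obtain ⟨a, ha⟩ := exists_const_of_hasDerivAt_zero isOpen_univ isPreconnected_univ
    (f := y₁) fun x _ => hy₂ x ▸ h₂ x
  have ha0 : a = 0 := (ha 0 trivial).symm.trans i₁
  linear_combination -hw x + x * ha x trivial + x * ha0

/-- A solution on `ℝ` is determined by its initial values at the origin. -/
theorem IsSolutionOn.eq_of_initial_values {y y₁ y₂ z z₁ z₂ : ℝ → ℝ}
    (hy : IsSolutionOn Set.univ y) (hz : IsSolutionOn Set.univ z)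
    (hy₁ : ∀ x, HasDerivAt y (y₁ x) x) (hy₂ : ∀ x, HasDerivAt y₁ (y₂ x) x)
    (hz₁ : ∀ x, HasDerivAt z (z₁ x) x) (hz₂ : ∀ x, HasDerivAt z₁ (z₂ x) x)
    (i₀ : y 0 = z 0) (i₁ : y₁ 0 = z₁ 0) (i₂ : y₂ 0 = z₂ 0) : y = z :=
  funext fun x => sub_eq_zero.1 <| (hy.sub hz).eq_zero_of_initial_values
    (fun x => (hy₁ x).sub (hz₁ x)) (fun x => (hy₂ x).sub (hz₂ x))
    (sub_eq_zero.2 i₀) (sub_eq_zero.2 i₁) (sub_eq_zero.2 i₂) x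

theorem existsUnique_isSeriesSolutionOne : ∃! y : ℝ → ℝ, IsSeriesSolutionOne y := by
  obtain ⟨y, hy, c, hc, h⟩ := exists_isSeriesSolution (Or.inl rfl)
  have h1 : IsSeriesSolutionOne y := ⟨hy, c, hc, by simpa using h⟩
  refine ⟨y, h1, fun z hz => ?_⟩
  obtain ⟨y₁, y₂, _, hy'⟩ := hy
  obtain ⟨z₁, z₂, _, hz'⟩ := hz.1
  have iy := h1.initial_values (fun x => (hy' x trivial).1) (fun x => (hy' x trivial).2.1)
  have iz := hz.initial_values (fun x => (hz' x trivial).1) (fun x => (hz' x trivial).2.1)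
  exact hz.1.eq_of_initial_values h1.1 (fun x => (hz' x trivial).1)
    (fun x => (hz' x trivial).2.1) (fun x => (hy' x trivial).1) (fun x => (hy' x trivial).2.1)
    (by rw [iy.1, iz.1]) (by rw [iy.2.1, iz.2.1]) (by rw [iy.2.2, iz.2.2])

theorem existsUnique_isSeriesSolutionTwo : ∃! y : ℝ → ℝ, IsSeriesSolutionTwo y := by
  obtain ⟨y, hy, c, hc, h⟩ := exists_isSeriesSolution (Or.inr rfl)
  have h1 : IsSeriesSolutionTwo y := ⟨hy, c, hc, h⟩
  refine ⟨y, h1, fun z hz => ?_⟩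
  obtain ⟨y₁, y₂, _, hy'⟩ := hy
  obtain ⟨z₁, z₂, _, hz'⟩ := hz.1
  have iy := h1.initial_values (fun x => (hy' x trivial).1) (fun x => (hy' x trivial).2.1)
  have iz := hz.initial_values (fun x => (hz' x trivial).1) (fun x => (hz' x trivial).2.1)
  exact hz.1.eq_of_initial_values h1.1 (fun x => (hz' x trivial).1)
    (fun x => (hz' x trivial).2.1) (fun x => (hy' x trivial).1) (fun x => (hy' x trivial).2.1)
    (by rw [iy.1, iz.1]) (by rw [iy.2.1, iz.2.1]) (by rw [iy.2.2, iz.2.2])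

/-! ### The incomplete Gamma tail and its asymptotics -/

theorem integrableOn_mul_exp_neg_cube :
    MeasureTheory.IntegrableOn (fun s : ℝ => s * Real.exp (-(s ^ 3 / 3))) (Set.Ioi 0) := by
  have h := integrableOn_rpow_mul_exp_neg_mul_rpow (p := 3) (s := 1) (b := 1 / 3)
    (by norm_num) (by norm_num) (by norm_num)
  refine h.congr_fun (fun x _ => ?_) measurableSet_Ioi
  have : x ^ (3 : ℝ) = x ^ 3 := by exact_mod_cast Real.rpow_natCast x 3
  simp only [Real.rpow_one, this]
  congr 2
  ring

theorem integral_mul_exp_neg_cube :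
    ∫ s in Set.Ioi (0 : ℝ), s * Real.exp (-(s ^ 3 / 3)) =
      (3 : ℝ) ^ (-(1 / 3) : ℝ) * Real.Gamma (2 / 3) := by
  have h := integral_rpow_mul_exp_neg_mul_rpow (p := 3) (q := 1) (b := 1 / 3)
    (by norm_num) (by norm_num) (by norm_num)
  calc _ = ∫ x in Set.Ioi (0 : ℝ), x ^ (1 : ℝ) * Real.exp (-(1 / 3) * x ^ (3 : ℝ)) := by
        refine MeasureTheory.setIntegral_congr_fun measurableSet_Ioi (fun x _ => ?_)
        have : x ^ (3 : ℝ) = x ^ 3 := by exact_mod_cast Real.rpow_natCast x 3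
        simp only [Real.rpow_one, this]
        congr 2
        ring
    _ = _ := by
        rw [h, one_div, Real.inv_rpow (by norm_num), ← Real.rpow_neg (by norm_num),
          show (3 : ℝ)⁻¹ = 3 ^ (-1 : ℝ) by rw [Real.rpow_neg_one],
          ← Real.rpow_add (by norm_num)]
        norm_num

theorem tendsto_cubicTail : Tendsto cubicTail atTop (nhds 0) := by
  have h := MeasureTheory.intervalIntegral_tendsto_integral_Ioi 0 integrableOn_mul_exp_neg_cube
    tendsto_id
  rw [integral_mul_exp_neg_cube] at h
  have h' := h.const_sub ((3 : ℝ) ^ (-(1 / 3) : ℝ) * Real.Gamma (2 / 3))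
  rwa [sub_self] at h'

theorem nonneg_of_hasDerivAt_nonpos_of_tendsto_zero {f f' : ℝ → ℝ}
    (hf : ∀ x, 0 < x → HasDerivAt f (f' x) x) (hf' : ∀ x, 0 < x → f' x ≤ 0)
    (h0 : Tendsto f atTop (nhds 0)) {x : ℝ} (hx : 0 < x) : 0 ≤ f x := by
  have ha : AntitoneOn f (Set.Ioi 0) := by
    refine antitoneOn_of_deriv_nonpos (convex_Ioi 0)
      (fun y hy => (hf y hy).continuousAt.continuousWithinAt) ?_ ?_
    · rw [interior_Ioi]
      exact fun y hy => (hf y hy).differentiableAt.differentiableWithinAt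
    · rw [interior_Ioi]
      exact fun y hy => (hf y hy).deriv ▸ hf' y hy
  exact le_of_tendsto h0 ((eventually_ge_atTop x).mono fun y hy => ha hx (hx.trans_le hy) hy)

theorem tendsto_exp_neg_cube_div :
    Tendsto (fun x : ℝ => Real.exp (-(x ^ 3 / 3)) / x) atTop (nhds 0) := by
  have h : Tendsto (fun x : ℝ => Real.exp (-(x ^ 3 / 3))) atTop (nhds 0) :=
    Real.tendsto_exp_neg_atTop_nhds_zero.comp
      ((tendsto_pow_atTop (by norm_num)).atTop_div_const (by norm_num))
  simpa [div_eq_mul_inv] using h.mul tendsto_inv_atTop_zero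

theorem hasDerivAt_exp_neg_cube_div {x : ℝ} (hx : 0 < x) :
    HasDerivAt (fun x : ℝ => Real.exp (-(x ^ 3 / 3)) / x)
      (-x * Real.exp (-(x ^ 3 / 3)) - Real.exp (-(x ^ 3 / 3)) / x ^ 2) x := by
  refine ((hasDerivAt_exp_neg_cube x).div (hasDerivAt_id' x) hx.ne').congr_deriv ?_
  field_simp

theorem cubicTail_nonneg {x : ℝ} (hx : 0 < x) : 0 ≤ cubicTail x :=
  nonneg_of_hasDerivAt_nonpos_of_tendsto_zero (fun x _ => hasDerivAt_cubicTail x)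
    (fun x hx => by nlinarith [Real.exp_pos (-(x ^ 3 / 3))]) tendsto_cubicTail hx

/-- The integral of `exp (-u³ / 3) / u²` over `u > x`. -/
noncomputable def inverseSquareTail (x : ℝ) : ℝ := Real.exp (-(x ^ 3 / 3)) / x - cubicTail x

theorem hasDerivAt_inverseSquareTail {x : ℝ} (hx : 0 < x) :
    HasDerivAt inverseSquareTail (-(Real.exp (-(x ^ 3 / 3)) / x ^ 2)) x :=
  ((hasDerivAt_exp_neg_cube_div hx).sub (hasDerivAt_cubicTail x)).congr_deriv (by ring)

theorem tendsto_inverseSquareTail : Tendsto inverseSquareTail atTop (nhds 0) := by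
  have h := tendsto_exp_neg_cube_div.sub tendsto_cubicTail
  rwa [sub_zero] at h

theorem cubicTail_le {x : ℝ} (hx : 0 < x) : cubicTail x ≤ Real.exp (-(x ^ 3 / 3)) / x :=
  sub_nonneg.1 <| nonneg_of_hasDerivAt_nonpos_of_tendsto_zero
    (fun _ hx => hasDerivAt_inverseSquareTail hx) (fun x _ => neg_nonpos.2 (by positivity))
    tendsto_inverseSquareTail hx

/-- The tail `cubicTail` relative to its exponential decay. -/
noncomputable def scaledTail (x : ℝ) : ℝ := Real.exp (x ^ 3 / 3) * cubicTail x

theorem hasDerivAt_scaledTail (x : ℝ) :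
    HasDerivAt scaledTail (x ^ 2 * scaledTail x - x) x := by
  refine ((hasDerivAt_exp_cube x).mul (hasDerivAt_cubicTail x)).congr_deriv ?_
  unfold scaledTail
  linear_combination -x * exp_cube_mul_exp_neg_cube x

theorem continuous_scaledTail : Continuous scaledTail :=
  continuous_iff_continuousAt.2 fun x => (hasDerivAt_scaledTail x).continuousAt

theorem one_sub_mul_scaledTail {x : ℝ} (hx : 0 < x) :
    1 - x * scaledTail x = x * Real.exp (x ^ 3 / 3) * inverseSquareTail x := by
  unfold scaledTail inverseSquareTail
  have := exp_cube_mul_exp_neg_cube x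
  field_simp
  linear_combination -this

/-- L'Hôpital's rule for `cubicTail x` against `exp (-x³/3) / x`: the quotient of derivatives is `1
/ (1 + x⁻³)`. -/
theorem tendsto_mul_scaledTail : Tendsto (fun x => x * scaledTail x) atTop (nhds 1) := by
  have h : Tendsto (fun x : ℝ => cubicTail x / (Real.exp (-(x ^ 3 / 3)) / x)) atTop (nhds 1) := by
    refine HasDerivAt.lhopital_zero_atTop (.of_forall hasDerivAt_cubicTail)
      ((eventually_gt_atTop 0).mono fun x hx => hasDerivAt_exp_neg_cube_div hx)
      ((eventually_gt_atTop 0).mono fun x hx => ?_) tendsto_cubicTail tendsto_exp_neg_cube_div ?_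
    · have h1 : 0 < x * Real.exp (-(x ^ 3 / 3)) := by positivity
      have h2 : 0 < Real.exp (-(x ^ 3 / 3)) / x ^ 2 := by positivity
      linarith
    · have h3 : Tendsto (fun x : ℝ => (1 + (x ^ 3)⁻¹)⁻¹) atTop (nhds 1) := by
        have := ((tendsto_inv_atTop_zero.comp
          (tendsto_pow_atTop (α := ℝ) (n := 3) (by norm_num))).const_add 1).inv₀ (by norm_num)
        simpa using this
      refine h3.congr' ((eventually_gt_atTop 0).mono fun x hx => ?_)
      have := Real.exp_pos (-(x ^ 3 / 3))
      rw [inv_eq_one_div, div_eq_div_iff (by positivity)]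
      · field_simp
        ring
      · have h1 : 0 < x * Real.exp (-(x ^ 3 / 3)) := by positivity
        have h2 : 0 < Real.exp (-(x ^ 3 / 3)) / x ^ 2 := by positivity
        linarith
  refine h.congr' ((eventually_gt_atTop 0).mono fun x hx => ?_)
  have := exp_cube_mul_exp_neg_cube x
  have h0 := (Real.exp_pos (-(x ^ 3 / 3))).ne'
  unfold scaledTail
  rw [div_div_eq_mul_div, div_eq_iff h0]
  linear_combination -(x * cubicTail x) * this

theorem tendsto_scaledTail_div : Tendsto (fun x => scaledTail x / x) atTop (nhds 0) := by
  have h := tendsto_mul_scaledTail.mul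
    (tendsto_inv_atTop_zero.comp (tendsto_pow_atTop (α := ℝ) (n := 2) (by norm_num)))
  rw [mul_zero] at h
  refine h.congr' ((eventually_gt_atTop 0).mono fun x hx => ?_)
  simp only [Function.comp]
  field_simp

/-! ### Construction of the decaying solution -/

/-- The derivative of the decaying solution. -/
noncomputable def decayingDeriv (x : ℝ) : ℝ :=
  -2 * (3 : ℝ) ^ (-(2 / 3) : ℝ) * Real.Gamma (2 / 3) ^ 2 +
    2 * ∫ s in (0 : ℝ)..x, (1 - s * scaledTail s)

/-- The solution asymptotic to `x⁻¹` at infinity. -/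
noncomputable def decayingSolution (x : ℝ) : ℝ := x * decayingDeriv x + 2 * scaledTail x

theorem hasDerivAt_decayingDeriv (x : ℝ) :
    HasDerivAt decayingDeriv (2 * (1 - x * scaledTail x)) x := by
  have hc : Continuous fun s : ℝ => 1 - s * scaledTail s :=
    continuous_const.sub (continuous_id.mul continuous_scaledTail)
  exact ((hc.integral_hasStrictDerivAt 0 x).hasDerivAt.const_mul 2).const_add _

theorem hasDerivAt_decayingSolution (x : ℝ) :
    HasDerivAt decayingSolution (decayingDeriv x) x := by
  refine (((hasDerivAt_id' x).mul (hasDerivAt_decayingDeriv x)).add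
    ((hasDerivAt_scaledTail x).const_mul 2)).congr_deriv ?_
  ring

theorem isSolutionOn_decayingSolution : IsSolutionOn Set.univ decayingSolution := by
  refine ⟨_, _, fun x => 2 * (-(1 * scaledTail x + x * (x ^ 2 * scaledTail x - x))),
    fun x _ => ⟨hasDerivAt_decayingSolution x, hasDerivAt_decayingDeriv x, ?_, ?_⟩⟩
  · exact (((hasDerivAt_id' x).mul (hasDerivAt_scaledTail x)).const_sub 1).const_mul 2
  · unfold decayingSolution
    ring

theorem decayingSolution_zero :
    decayingSolution 0 = 2 * (3 : ℝ) ^ (-(1 / 3) : ℝ) * Real.Gamma (2 / 3) := by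
  simp [decayingSolution, scaledTail, cubicTail_zero]
  ring

theorem decayingDeriv_zero :
    decayingDeriv 0 = -2 * (3 : ℝ) ^ (-(2 / 3) : ℝ) * Real.Gamma (2 / 3) ^ 2 := by
  simp [decayingDeriv]

/-! ### The slope at the origin as a Beta integral -/

theorem integral_beta {α β : ℝ} (hα : 0 < α) (hβ : 0 < β) :
    IntegrableOn (fun x : ℝ => x ^ (α - 1) * (1 - x) ^ (β - 1)) (Set.Ioo 0 1) ∧
    ∫ x in Set.Ioo (0 : ℝ) 1, x ^ (α - 1) * (1 - x) ^ (β - 1) =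
      Real.Gamma α * Real.Gamma β / Real.Gamma (α + β) := by
  have hc := (intervalIntegrable_iff_integrableOn_Ioo_of_le zero_le_one).1
    (Complex.betaIntegral_convergent (u := α) (v := β) (by simpa) (by simpa))
  have he : Set.EqOn (fun x : ℝ => ((x : ℂ) ^ ((α : ℂ) - 1) * (1 - (x : ℂ)) ^ ((β : ℂ) - 1)).re)
      (fun x : ℝ => x ^ (α - 1) * (1 - x) ^ (β - 1)) (Set.Ioo 0 1) := by
    intro x hx
    have h1 : (1 - (x : ℂ)) = ((1 - x : ℝ) : ℂ) := by push_cast; ring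
    have h2 : ((β : ℂ) - 1) = ((β - 1 : ℝ) : ℂ) := by push_cast; ring
    have h3 : ((α : ℂ) - 1) = ((α - 1 : ℝ) : ℂ) := by push_cast; ring
    simp only [h1, h2, h3]
    rw [← Complex.ofReal_cpow hx.1.le, ← Complex.ofReal_cpow (by linarith [hx.2]),
      ← Complex.ofReal_mul, Complex.ofReal_re]
  refine ⟨IntegrableOn.congr_fun hc.re he measurableSet_Ioo, ?_⟩
  rw [← setIntegral_congr_fun measurableSet_Ioo he]
  have := ProbabilityTheory.beta_eq_betaIntegralReal α β hα hβ
  rw [Complex.betaIntegral, intervalIntegral.integral_of_le zero_le_one,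
    integral_Ioc_eq_integral_Ioo, ← RCLike.re_to_complex, ← integral_re hc] at this
  exact this.symm

/-- The kernel that represents `1 - s * scaledTail s`. -/
noncomputable def tailKernel (s q : ℝ) : ℝ :=
  1 / 3 * q ^ (-(2 / 3) : ℝ) * Real.exp (-((1 - q) / (3 * q)) * s ^ 3)

theorem tailKernel_nonneg (s : ℝ) {q : ℝ} (hq : 0 < q) : 0 ≤ tailKernel s q := by
  unfold tailKernel; positivity

theorem measurable_tailKernel : Measurable (Function.uncurry tailKernel) := by
  unfold tailKernel Function.uncurry
  fun_prop

theorem integrableOn_tailKernel {s : ℝ} (hs : 0 < s) :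
    IntegrableOn (tailKernel s) (Set.Ioo 0 1) := by
  have h : IntegrableOn (fun q : ℝ => 1 / 3 * q ^ (-(2 / 3) : ℝ)) (Set.Ioo 0 1) :=
    ((intervalIntegrable_iff_integrableOn_Ioo_of_le zero_le_one).1
      (intervalIntegral.intervalIntegrable_rpow' (by norm_num))).const_mul _
  refine Integrable.mono' h
    (measurable_tailKernel.of_uncurry_left (x := s)).aestronglyMeasurable ?_
  refine (ae_restrict_iff' measurableSet_Ioo).2 (.of_forall fun q hq => ?_)
  rw [Real.norm_of_nonneg (tailKernel_nonneg s hq.1)]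
  have h0 : 0 ≤ (1 - q) / (3 * q) := div_nonneg (by linarith [hq.2]) (by linarith [hq.1])
  have : Real.exp (-((1 - q) / (3 * q)) * s ^ 3) ≤ 1 :=
    Real.exp_le_one_iff.2 (by have := pow_pos hs 3; nlinarith)
  have hq0 := Real.rpow_pos_of_pos hq.1 (-(2 / 3))
  unfold tailKernel
  exact mul_le_of_le_one_right (by positivity) this

/-- By `one_sub_mul_scaledTail`, the right side is `s exp (s³/3) ∫ₛ^∞ exp (-u³/3) / u² du`; the
substitution `u = s q^(-1/3)` turns it into the left side. The proof differentiates the substituted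
tail and takes its limits at `q → 0` (where `u → ∞`) and `q → 1`. -/
theorem integral_tailKernel {s : ℝ} (hs : 0 < s) :
    ∫ q in Set.Ioo (0 : ℝ) 1, tailKernel s q = 1 - s * scaledTail s := by
  have hd : ∀ q ∈ Set.Ioo (0 : ℝ) 1, HasDerivAt
      (fun q : ℝ => s * Real.exp (s ^ 3 / 3) * inverseSquareTail (s * q ^ (-(1 / 3) : ℝ)))
      (tailKernel s q) q := by
    intro q hq
    have hq0 := hq.1
    have hr : 0 < q ^ (-(1 / 3) : ℝ) := Real.rpow_pos_of_pos hq0 _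
    have h := ((hasDerivAt_inverseSquareTail (mul_pos hs hr)).comp q
      ((Real.hasDerivAt_rpow_const (p := (-(1 / 3) : ℝ)) (Or.inl hq0.ne')).const_mul s)).const_mul
        (s * Real.exp (s ^ 3 / 3))
    refine h.congr_deriv ?_
    have e1 : (q ^ (-(1 / 3) : ℝ)) ^ 3 = q⁻¹ := by
      rw [← Real.rpow_natCast, ← Real.rpow_mul hq0.le, ← Real.rpow_neg_one]
      norm_num
    have e2 : (q ^ (-(1 / 3) : ℝ)) ^ 2 = q ^ (-(2 / 3) : ℝ) := by
      rw [← Real.rpow_natCast, ← Real.rpow_mul hq0.le]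
      norm_num
    have e3 : q ^ (-(1 / 3) - 1 : ℝ) = q ^ (-(2 / 3) : ℝ) * q ^ (-(2 / 3) : ℝ) := by
      rw [← Real.rpow_add hq0]
      norm_num
    have e4 : Real.exp (-((1 - q) / (3 * q)) * s ^ 3) =
        Real.exp (s ^ 3 / 3) * Real.exp (-(s ^ 3 * q⁻¹ / 3)) := by
      rw [← Real.exp_add]
      congr 1
      field_simp
      ring
    have hr2 := (Real.rpow_pos_of_pos hq0 (-(2 / 3) : ℝ)).ne'
    unfold tailKernel
    rw [mul_pow, mul_pow, e1, e2, e3, e4]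
    field_simp
  have h0 : Tendsto
      (fun q : ℝ => s * Real.exp (s ^ 3 / 3) * inverseSquareTail (s * q ^ (-(1 / 3) : ℝ)))
      (nhdsWithin 0 (Set.Ioi 0)) (nhds 0) := by
    have h1 : Tendsto (fun q : ℝ => q ^ (-(1 / 3) : ℝ)) (nhdsWithin 0 (Set.Ioi 0)) atTop :=
      tendsto_rpow_neg_nhdsGT_zero (by norm_num)
    simpa using (tendsto_inverseSquareTail.comp (h1.const_mul_atTop hs)).const_mul
      (s * Real.exp (s ^ 3 / 3))
  have h1 : Tendsto
      (fun q : ℝ => s * Real.exp (s ^ 3 / 3) * inverseSquareTail (s * q ^ (-(1 / 3) : ℝ)))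
      (nhdsWithin 1 (Set.Iio 1)) (nhds (1 - s * scaledTail s)) := by
    have hc : ContinuousAt
        (fun q : ℝ => s * Real.exp (s ^ 3 / 3) * inverseSquareTail (s * q ^ (-(1 / 3) : ℝ))) 1 := by
      refine continuousAt_const.mul (ContinuousAt.comp (g := inverseSquareTail) ?_ ?_)
      · rw [Real.one_rpow, mul_one]
        exact (hasDerivAt_inverseSquareTail hs).continuousAt
      · exact continuousAt_const.mul (Real.continuousAt_rpow_const _ _ (Or.inl one_ne_zero))
    have := hc.tendsto
    rw [Real.one_rpow, mul_one, ← one_sub_mul_scaledTail hs] at this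
    exact this.mono_left nhdsWithin_le_nhds
  have := intervalIntegral.integral_eq_sub_of_hasDerivAt_of_tendsto zero_lt_one hd
    ((intervalIntegrable_iff_integrableOn_Ioo_of_le zero_le_one).2 (integrableOn_tailKernel hs))
    h0 h1
  rw [← integral_Ioc_eq_integral_Ioo, ← intervalIntegral.integral_of_le zero_le_one, this, sub_zero]

/-- For fixed `q` the kernel is a multiple of `exp (-b s³)` with `b = (1 - q) / (3 q)`, whose
integral is `b^(-1/3) Γ(4/3)`. The result is a Beta integrand with both parameters `2/3`. -/
theorem tailKernel_slice {q : ℝ} (hq : q ∈ Set.Ioo (0 : ℝ) 1) :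
    IntegrableOn (fun s => tailKernel s q) (Set.Ioi 0) ∧
    ∫ s in Set.Ioi (0 : ℝ), tailKernel s q =
      1 / 3 * (3 : ℝ) ^ (1 / 3 : ℝ) * Real.Gamma (4 / 3) *
        (q ^ (2 / 3 - 1 : ℝ) * (1 - q) ^ (2 / 3 - 1 : ℝ)) := by
  have hq0 := hq.1
  have hq1 : 0 < 1 - q := by linarith [hq.2]
  have hb : 0 < (1 - q) / (3 * q) := by positivity
  have he : ∀ s : ℝ, tailKernel s q =
      1 / 3 * q ^ (-(2 / 3) : ℝ) * Real.exp (-((1 - q) / (3 * q)) * s ^ (3 : ℝ)) := by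
    intro s
    have : s ^ (3 : ℝ) = s ^ 3 := by exact_mod_cast Real.rpow_natCast s 3
    rw [this, tailKernel]
  simp only [he]
  constructor
  · have := integrableOn_rpow_mul_exp_neg_mul_rpow (p := 3) (s := 0) (by norm_num) (by norm_num) hb
    simp only [Real.rpow_zero, one_mul] at this
    exact this.const_mul _
  · rw [integral_const_mul, integral_exp_neg_mul_rpow (by norm_num) hb,
      Real.div_rpow hq1.le (by positivity), Real.mul_rpow (by norm_num) hq0.le,
      show (2 / 3 - 1 : ℝ) = -(1 / 3) by norm_num, show (-1 / 3 : ℝ) = -(1 / 3) by norm_num,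
      show (-(2 / 3) : ℝ) = -(1 / 3) + -(1 / 3) by norm_num, Real.rpow_add hq0,
      Real.rpow_neg (by norm_num : (0 : ℝ) ≤ 3), show (1 / 3 + 1 : ℝ) = 4 / 3 by norm_num]
    have h1 := (Real.rpow_pos_of_pos hq0 (-(1 / 3))).ne'
    have h3 := (Real.rpow_pos_of_pos (by norm_num : (0 : ℝ) < 3) (1 / 3)).ne'
    field_simp

theorem integrable_tailKernel : Integrable (Function.uncurry tailKernel)
    ((volume.restrict (Set.Ioi 0)).prod (volume.restrict (Set.Ioo 0 1))) := by
  refine (integrable_prod_iff' measurable_tailKernel.aestronglyMeasurable).2 ⟨?_, ?_⟩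
  · exact (ae_restrict_iff' measurableSet_Ioo).2 (.of_forall fun q hq => (tailKernel_slice hq).1)
  · have h := (integral_beta (α := 2 / 3) (β := 2 / 3) (by norm_num) (by norm_num)).1.const_mul
      (1 / 3 * (3 : ℝ) ^ (1 / 3 : ℝ) * Real.Gamma (4 / 3))
    refine IntegrableOn.congr_fun h (fun q hq => ?_) measurableSet_Ioo
    rw [← (tailKernel_slice hq).2]
    exact integral_congr_ae (.of_forall fun s =>
      (Real.norm_of_nonneg (tailKernel_nonneg s hq.1)).symm)

theorem integrableOn_one_sub_mul_scaledTail :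
    IntegrableOn (fun s => 1 - s * scaledTail s) (Set.Ioi 0) :=
  IntegrableOn.congr_fun integrable_tailKernel.integral_prod_left
    (fun _ hs => integral_tailKernel hs) measurableSet_Ioi

theorem integral_one_sub_mul_scaledTail :
    ∫ s in Set.Ioi (0 : ℝ), (1 - s * scaledTail s) =
      (3 : ℝ) ^ (-(2 / 3) : ℝ) * Real.Gamma (2 / 3) ^ 2 := by
  rw [← setIntegral_congr_fun measurableSet_Ioi (fun s hs => integral_tailKernel hs),
    integral_integral_swap integrable_tailKernel,
    setIntegral_congr_fun measurableSet_Ioo (fun q hq => (tailKernel_slice hq).2),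
    integral_const_mul, (integral_beta (by norm_num) (by norm_num)).2,
    show (2 / 3 + 2 / 3 : ℝ) = 4 / 3 by norm_num,
    show (-(2 / 3) : ℝ) = 1 / 3 - 1 by norm_num, Real.rpow_sub_one (by norm_num)]
  -- The factor `Γ(4/3)` from the slices cancels the denominator of the Beta value.
  have := (Real.Gamma_pos_of_pos (by norm_num : (0 : ℝ) < 4 / 3)).ne'
  field_simp

/-! ### Behaviour of the decaying solution at infinity -/

theorem tendsto_decayingDeriv : Tendsto decayingDeriv atTop (nhds 0) := by
  have h := intervalIntegral_tendsto_integral_Ioi 0 integrableOn_one_sub_mul_scaledTail tendsto_id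
  rw [integral_one_sub_mul_scaledTail] at h
  have := (h.const_mul 2).const_add (-2 * (3 : ℝ) ^ (-(2 / 3) : ℝ) * Real.Gamma (2 / 3) ^ 2)
  refine Tendsto.congr (fun x => rfl) (this.trans_eq ?_)
  congr 1
  ring

theorem tendsto_decayingSolution_div : Tendsto (fun x => decayingSolution x / x) atTop (nhds 0) := by
  have h := tendsto_decayingDeriv.add (tendsto_scaledTail_div.const_mul 2)
  rw [mul_zero, add_zero] at h
  refine h.congr' ((eventually_gt_atTop 0).mono fun x hx => ?_)
  unfold decayingSolution
  field_simp

theorem hasDerivAt_decayingSolution_div {x : ℝ} (hx : 0 < x) :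
    HasDerivAt (fun x => decayingSolution x / x) (-2 * scaledTail x / x ^ 2) x := by
  refine ((hasDerivAt_decayingSolution x).div (hasDerivAt_id' x) hx.ne').congr_deriv ?_
  unfold decayingSolution
  field_simp
  ring

/-- L'Hôpital's rule for `decayingSolution x / x` against `x⁻²`: the quotient of derivatives is
exactly `x * scaledTail x`. The numerator tends to zero only because the slope does. -/
theorem tendsto_mul_decayingSolution :
    Tendsto (fun x => x * decayingSolution x) atTop (nhds 1) := by
  have h : Tendsto (fun x : ℝ => (decayingSolution x / x) / (x ^ 2)⁻¹) atTop (nhds 1) := by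
    refine HasDerivAt.lhopital_zero_atTop (g' := fun x => -(2 * x) / (x ^ 2) ^ 2)
      ((eventually_gt_atTop 0).mono fun x hx => hasDerivAt_decayingSolution_div hx)
      ((eventually_gt_atTop 0).mono fun x hx => ?_)
      ((eventually_gt_atTop 0).mono fun x hx => ?_) tendsto_decayingSolution_div
      (tendsto_inv_atTop_zero.comp (tendsto_pow_atTop (by norm_num))) ?_
    · refine ((hasDerivAt_pow 2 x).inv (by positivity)).congr_deriv ?_
      norm_num
    · exact (div_neg_of_neg_of_pos (by linarith) (by positivity)).ne
    · refine tendsto_mul_scaledTail.congr' ((eventually_gt_atTop 0).mono fun x hx => ?_)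
      field_simp
  refine h.congr' ((eventually_gt_atTop 0).mono fun x hx => ?_)
  field_simp

theorem isEquivalent_inv_iff {y : ℝ → ℝ} :
    y ~[atTop] (fun x : ℝ => x⁻¹) ↔ Tendsto (fun x => x * y x) atTop (nhds 1) := by
  rw [isEquivalent_iff_tendsto_one ((eventually_gt_atTop 0).mono fun x hx => inv_ne_zero hx.ne')]
  refine tendsto_congr fun x => ?_
  simp [mul_comm]

theorem isDecayingSolution_decayingSolution : IsDecayingSolution decayingSolution :=
  ⟨isSolutionOn_decayingSolution, isEquivalent_inv_iff.2 tendsto_mul_decayingSolution⟩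

/-! ### Uniqueness at infinity -/

/-- A solution near infinity that is `o(x⁻¹)` vanishes. -/
theorem IsSolutionOn.eq_zero_of_tendsto {X : ℝ} {z : ℝ → ℝ} (hz : IsSolutionOn (Set.Ioi X) z)
    (h0 : Tendsto (fun x => x * z x) atTop (nhds 0)) {x : ℝ} (hx : X < x) : z x = 0 := by
  obtain ⟨C, D, z₁, z₂, h⟩ := hz.exists_first_integrals isOpen_Ioi isPreconnected_Ioi
    hasDerivAt_cubicTail
  -- Since `(z / x)' = w / x²`, the added term cancels the `C` contribution and leaves `u' = D exp
  -- (x³/3) / x²`.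
  set u : ℝ → ℝ := fun x => z x / x + C / 2 * (decayingSolution x / x) with hu
  have hud : ∀ x ∈ Set.Ioi (max X 0), HasDerivAt u (D * (Real.exp (x ^ 3 / 3) / x ^ 2)) x := by
    intro x hx
    obtain ⟨hX, hx0⟩ := max_lt_iff.1 (Set.mem_Ioi.1 hx)
    refine (((h x hX).1.div (hasDerivAt_id' x) hx0.ne').add
      ((hasDerivAt_decayingSolution_div hx0).const_mul _)).congr_deriv ?_
    have hw := (h x hX).2.2.2
    unfold scaledTail
    field_simp
    linear_combination hw
  have hu0 : Tendsto u atTop (nhds 0) := by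
    have h1 : Tendsto (fun x => z x / x) atTop (nhds 0) := by
      have := h0.mul (tendsto_inv_atTop_zero.comp (tendsto_pow_atTop (α := ℝ) (n := 2)
        (by norm_num)))
      rw [mul_zero] at this
      refine this.congr' ((eventually_gt_atTop 0).mono fun x hx => ?_)
      simp only [Function.comp]
      field_simp
    simpa using h1.add (tendsto_decayingSolution_div.const_mul (C / 2))
  have hD : D = 0 := by
    by_contra hD
    -- Unit increments of `u` tend to zero, but by the mean value theorem they are at least `|D| /
    -- 3` in absolute value, as `exp (ξ³/3) ≥ ξ² / 3` for `ξ > 1`.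
    have h1 : Tendsto (fun x => u (x + 1) - u x) atTop (nhds 0) := by
      simpa using (hu0.comp (tendsto_atTop_add_const_right _ 1 tendsto_id)).sub hu0
    have hpos : 0 < |D| / 3 := by positivity
    obtain ⟨x, hx1, hx2⟩ := ((h1.abs.eventually_lt_const (u := |D| / 3) (by rwa [abs_zero])).and
      (eventually_gt_atTop (max (max X 0) 1))).exists
    obtain ⟨hxm, hx1'⟩ := max_lt_iff.1 hx2
    obtain ⟨ξ, hξ, he⟩ := exists_hasDerivAt_eq_slope u _ (lt_add_one x)
      (fun y hy => (hud y (hxm.trans_le hy.1)).continuousAt.continuousWithinAt)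
      (fun y hy => hud y (hxm.trans hy.1))
    rw [add_sub_cancel_left, div_one] at he
    rw [← he, abs_mul] at hx1
    have hξ1 : 1 < ξ := hx1'.trans hξ.1
    have hexp := Real.add_one_le_exp (ξ ^ 3 / 3)
    have hq : 1 / 3 ≤ Real.exp (ξ ^ 3 / 3) / ξ ^ 2 := by
      rw [le_div_iff₀ (by positivity)]
      nlinarith [sq_nonneg ξ]
    have := mul_le_mul_of_nonneg_left (hq.trans (le_abs_self _)) (abs_nonneg D)
    linarith
  obtain ⟨a, ha⟩ := exists_const_of_hasDerivAt_zero isOpen_Ioi isPreconnected_Ioi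
    (s := Set.Ioi (max X 0)) (f := u) fun x hx => by simpa [hD] using hud x hx
  have hev : ∀ᶠ x in atTop, u x = a := (eventually_gt_atTop (max X 0)).mono ha
  have ha0 : a = 0 := tendsto_nhds_unique (tendsto_const_nhds.congr' (hev.mono fun _ h => h.symm)) hu0
  have hzY : ∀ x ∈ Set.Ioi (max X 0), z x = -(C / 2) * decayingSolution x := by
    intro x hx
    have hx0 : 0 < x := (max_lt_iff.1 (Set.mem_Ioi.1 hx)).2
    have := (ha x hx).trans ha0
    simp only [hu] at this
    field_simp at this
    linear_combination this / 2
  have hC : C = 0 := by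
    have h1 : Tendsto (fun x => x * z x) atTop (nhds (-(C / 2) * 1)) := by
      refine (tendsto_mul_decayingSolution.const_mul (-(C / 2))).congr'
        ((eventually_gt_atTop (max X 0)).mono fun x hx => ?_)
      simp only [hzY x hx]
      ring
    linarith [tendsto_nhds_unique h1 h0]
  -- Division by `x` confined the argument to `x > max X 0`; the first integrals, valid on all of
  -- `(X, ∞)`, carry the conclusion to negative `x`.
  have hw : ∀ x ∈ Set.Ioi X, x * z₁ x - z x = 0 := fun x hx => by
    rw [(h x hx).2.2.2, hC, hD]; ring
  obtain ⟨b, hb⟩ := exists_const_of_hasDerivAt_zero isOpen_Ioi isPreconnected_Ioi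
    (s := Set.Ioi X) (f := z₁) fun x hx => by
      have h2 := (h x hx).2.1
      rwa [(h x hx).2.2.1, hw x hx, hC, mul_zero, sub_zero] at h2
  have hb0 : b = 0 := by
    obtain ⟨t, ht⟩ := exists_gt (max X 0)
    obtain ⟨hX, ht0⟩ := max_lt_iff.1 ht
    have h1 := hw t hX
    rw [hb t hX, hzY t ht, hC] at h1
    simpa [ht0.ne'] using h1
  linear_combination -hw x hx + x * hb x hx + x * hb0

theorem IsSolutionOn.eq_decayingSolution {X : ℝ} {y : ℝ → ℝ} (hy : IsSolutionOn (Set.Ioi X) y)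
    (h : y ~[atTop] (fun x : ℝ => x⁻¹)) {x : ℝ} (hx : X < x) : y x = decayingSolution x := by
  refine sub_eq_zero.1 ((hy.sub (isSolutionOn_decayingSolution.mono
    (Set.subset_univ _))).eq_zero_of_tendsto ?_ hx)
  have := (isEquivalent_inv_iff.1 h).sub tendsto_mul_decayingSolution
  rw [sub_self] at this
  exact this.congr fun x => by ring

theorem IsDecayingSolution.eq_decayingSolution {y : ℝ → ℝ} (hy : IsDecayingSolution y) :
    y = decayingSolution :=
  funext fun x => (hy.1.mono (Set.subset_univ _)).eq_decayingSolution hy.2 (sub_one_lt x)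

/-! ### The connection formula -/

theorem decayingSolution_eq {y₁ y₂ : ℝ → ℝ} (h₁ : IsSeriesSolutionOne y₁)
    (h₂ : IsSeriesSolutionTwo y₂) (x : ℝ) :
    decayingSolution x = 2 * (3 : ℝ) ^ (-(1 / 3) : ℝ) * Real.Gamma (2 / 3) * y₁ x + y₂ x
      - 2 * (3 : ℝ) ^ (-(2 / 3) : ℝ) * Real.Gamma (2 / 3) ^ 2 * x := by
  set A := 2 * (3 : ℝ) ^ (-(1 / 3) : ℝ) * Real.Gamma (2 / 3) with hA
  set B := 2 * (3 : ℝ) ^ (-(2 / 3) : ℝ) * Real.Gamma (2 / 3) ^ 2 with hB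
  obtain ⟨y₁', y₁'', _, d₁⟩ := h₁.1
  obtain ⟨y₂', y₂'', _, d₂⟩ := h₂.1
  obtain ⟨i₁, j₁, k₁⟩ := h₁.initial_values (fun x => (d₁ x trivial).1)
    (fun x => (d₁ x trivial).2.1)
  obtain ⟨i₂, j₂, k₂⟩ := h₂.initial_values (fun x => (d₂ x trivial).1)
    (fun x => (d₂ x trivial).2.1)
  refine congrFun (isSolutionOn_decayingSolution.eq_of_initial_values
    (z := fun x => A * y₁ x + y₂ x - B * x)
    (z₁ := fun x => A * y₁' x + y₂' x - B * 1) (z₂ := fun x => A * y₁'' x + y₂'' x)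
    (((h₁.1.const_mul A).add h₂.1).sub (isSolutionOn_id.const_mul B))
    hasDerivAt_decayingSolution hasDerivAt_decayingDeriv (fun x => ?_) (fun x => ?_) ?_ ?_ ?_) x
  · exact (((d₁ x trivial).1.const_mul A).add (d₂ x trivial).1).sub
      ((hasDerivAt_id' x).const_mul B)
  · exact (((d₁ x trivial).2.1.const_mul A).add (d₂ x trivial).2.1).sub_const _
  · simp only [decayingSolution_zero, i₁, i₂, ← hA]
    ring
  · simp only [decayingDeriv_zero, j₁, j₂]
    rw [hB]
    ring
  · simp only [k₁, k₂]
    ring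

/-! ### Numerical value at the origin -/

theorem Real.abs_exp_neg_sub_sum_le {t : ℝ} (ht : 0 ≤ t) (n : ℕ) :
    |Real.exp (-t) - ∑ k ∈ Finset.range n, (-t) ^ k / k.factorial| ≤
      t ^ n / n.factorial * Real.exp t := by
  have h (t : ℝ) : HasSum (fun k : ℕ => t ^ k / k.factorial) (Real.exp t) := by
    rw [Real.exp_eq_exp_ℝ]
    exact NormedSpace.expSeries_div_hasSum_exp t
  refine ((hasSum_nat_add_iff' n).2 (h (-t))).norm_le_of_bounded
    ((h t).mul_left (t ^ n / n.factorial)) fun k => ?_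
  rw [norm_div, norm_pow, norm_neg, Real.norm_of_nonneg ht, Real.norm_natCast, div_mul_div_comm,
    ← pow_add, add_comm n k]
  gcongr
  rw [mul_comm]
  exact_mod_cast Nat.le_of_dvd (Nat.factorial_pos _) (Nat.factorial_mul_factorial_dvd_factorial_add k n)

/-- Termwise integration of the Taylor polynomial. In the error, one factor `4` bounds `s`, the
other is the length of the interval, and `3 ^ 22` bounds `exp (64 / 3)`. -/
theorem integral_mul_exp_neg_cube_sub_sum_le (n : ℕ) :
    |(∫ s in (0 : ℝ)..4, s * Real.exp (-(s ^ 3 / 3))) -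
      ∑ k ∈ Finset.range n, (-1 : ℝ) ^ k / (3 ^ k * k.factorial) * (16 * 64 ^ k / (3 * k + 2))| ≤
      4 * ((64 / 3) ^ n / n.factorial * 3 ^ 22) * 4 := by
  have hs : ∑ k ∈ Finset.range n, (-1 : ℝ) ^ k / (3 ^ k * k.factorial) *
      (16 * 64 ^ k / (3 * k + 2)) =
      ∫ s in (0 : ℝ)..4, s * ∑ k ∈ Finset.range n, (-(s ^ 3 / 3)) ^ k / k.factorial := by
    simp_rw [Finset.mul_sum]
    rw [intervalIntegral.integral_finsetSum fun k _ =>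
      (by fun_prop : Continuous fun s : ℝ =>
        s * ((-(s ^ 3 / 3)) ^ k / (k.factorial : ℝ))).intervalIntegrable _ _]
    refine Finset.sum_congr rfl fun k _ => ?_
    have e : ∀ s : ℝ, s * ((-(s ^ 3 / 3)) ^ k / k.factorial) =
        (-1) ^ k / (3 ^ k * k.factorial) * s ^ (3 * k + 1) := by
      intro s
      rw [neg_pow, div_pow, ← pow_mul, pow_succ]
      field_simp
    simp_rw [e]
    rw [intervalIntegral.integral_const_mul, integral_pow]
    rw [show (64 : ℝ) = 4 ^ 3 by norm_num, ← pow_mul]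
    push_cast
    ring
  rw [hs, ← intervalIntegral.integral_sub
    ((by fun_prop : Continuous fun s : ℝ => s * Real.exp (-(s ^ 3 / 3))).intervalIntegrable _ _)
    ((by fun_prop : Continuous fun s : ℝ => s * ∑ k ∈ Finset.range n,
      (-(s ^ 3 / 3)) ^ k / (k.factorial : ℝ)).intervalIntegrable _ _)]
  have hexp : Real.exp (64 / 3) ≤ 3 ^ 22 := by
    calc Real.exp (64 / 3) ≤ Real.exp (22 * 1) := Real.exp_le_exp.2 (by norm_num)
      _ = Real.exp 1 ^ 22 := by
        rw [← Real.exp_nat_mul]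
        norm_num
      _ ≤ 3 ^ 22 := by
        gcongr
        linarith [Real.exp_one_lt_d9]
  have hb := intervalIntegral.norm_integral_le_of_norm_le_const (a := (0 : ℝ)) (b := 4)
    (f := fun s => s * Real.exp (-(s ^ 3 / 3)) -
      s * ∑ k ∈ Finset.range n, (-(s ^ 3 / 3)) ^ k / (k.factorial : ℝ))
    (C := 4 * ((64 / 3) ^ n / n.factorial * 3 ^ 22)) fun s hs => ?_
  · simpa using hb
  · rw [Set.uIoc_of_le (by norm_num)] at hs
    have hs0 := hs.1
    have h3 : s ^ 3 / 3 ≤ 64 / 3 := by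
      have := pow_le_pow_left₀ hs0.le hs.2 3
      linarith
    rw [← mul_sub, Real.norm_eq_abs, abs_mul, abs_of_pos hs0]
    refine mul_le_mul hs.2 ((Real.abs_exp_neg_sub_sum_le (by positivity) n).trans ?_)
      (abs_nonneg _) (by norm_num)
    gcongr
    exact (Real.exp_le_exp.2 h3).trans hexp

theorem cubicTail_four_le : cubicTail 4 ≤ 1 / 10 ^ 9 := by
  refine (cubicTail_le (by norm_num)).trans ?_
  have h : (10 : ℝ) ^ 9 ≤ Real.exp (4 ^ 3 / 3) := by
    calc (10 : ℝ) ^ 9 ≤ 2.7 ^ 21 := by norm_num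
      _ ≤ Real.exp 1 ^ 21 := by
        gcongr
        linarith [Real.exp_one_gt_d9]
      _ = Real.exp 21 := by
        rw [← Real.exp_nat_mul]
        norm_num
      _ ≤ _ := Real.exp_le_exp.2 (by norm_num)
  rw [Real.exp_neg, div_le_div_iff₀ (by norm_num) (by norm_num)]
  have := inv_anti₀ (by norm_num) h
  nlinarith

theorem abs_decayingSolution_zero_sub_lt :
    |decayingSolution 0 - 1.87778588| < 5 / 10 ^ 9 := by
  have h1 := abs_le.1 (integral_mul_exp_neg_cube_sub_sum_le 100)
  have h2 := cubicTail_four_le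
  have h3 : 0 ≤ cubicTail 4 := cubicTail_nonneg (by norm_num)
  have h4 : decayingSolution 0 =
      2 * (cubicTail 4 + ∫ s in (0 : ℝ)..4, s * Real.exp (-(s ^ 3 / 3))) := by
    rw [decayingSolution_zero, cubicTail]
    ring
  -- Error budget: truncation `10⁻¹⁰`, rounding of the sum `5 · 10⁻¹⁰` and tail beyond `4` at most
  -- `10⁻⁹`; doubled, `3.2 · 10⁻⁹`.
  have h5 : (4 * ((64 / 3) ^ 100 / (Nat.factorial 100) * 3 ^ 22) * 4 : ℝ) ≤ 1 / 10 ^ 10 := by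
    norm_num [Nat.factorial]
  have h6 : |∑ k ∈ Finset.range 100, (-1 : ℝ) ^ k / (3 ^ k * k.factorial) *
      (16 * 64 ^ k / (3 * k + 2)) - 0.93889294| ≤ 5 / 10 ^ 10 := by
    rw [abs_le]
    norm_num [Finset.sum_range_succ, Nat.factorial]
  rw [abs_le] at h6
  rw [h4, abs_lt]
  constructor <;> linarith

theorem mainTheorem1 :
    IsSolutionOn Set.univ (fun x : ℝ => x) ∧
    (∃! y₁ : ℝ → ℝ, IsSeriesSolutionOne y₁) ∧
    (∃! y₂ : ℝ → ℝ, IsSeriesSolutionTwo y₂) ∧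
    (∃! y : ℝ → ℝ, IsDecayingSolution y) ∧
    ∀ y₀ y₁ y₂ : ℝ → ℝ, (∀ x : ℝ, y₀ x = x) → IsSeriesSolutionOne y₁ → IsSeriesSolutionTwo y₂ →
      (∀ (X : ℝ) (y : ℝ → ℝ), IsSolutionOn (Set.Ioi X) y → y ~[atTop] (fun x : ℝ => x⁻¹) →
        ∀ x : ℝ, X < x →
          y x = 2 * (3 : ℝ) ^ (-(1 / 3) : ℝ) * Real.Gamma (2 / 3) * y₁ x + y₂ x
            - 2 * (3 : ℝ) ^ (-(2 / 3) : ℝ) * Real.Gamma (2 / 3) ^ 2 * y₀ x) ∧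
      (∀ y : ℝ → ℝ, IsDecayingSolution y →
        (∀ x : ℝ,
          y x = 2 * (3 : ℝ) ^ (-(1 / 3) : ℝ) * Real.Gamma (2 / 3) * y₁ x + y₂ x
            - 2 * (3 : ℝ) ^ (-(2 / 3) : ℝ) * Real.Gamma (2 / 3) ^ 2 * y₀ x) ∧
        y 0 = 2 * (3 : ℝ) ^ (-(1 / 3) : ℝ) * Real.Gamma (2 / 3) ∧
        |y 0 - 1.87778588| < 5 / 10 ^ 9) := by
  refine ⟨isSolutionOn_id, existsUnique_isSeriesSolutionOne, existsUnique_isSeriesSolutionTwo,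
    ⟨decayingSolution, isDecayingSolution_decayingSolution, fun y hy => hy.eq_decayingSolution⟩,
    fun y₀ y₁ y₂ h₀ h₁ h₂ => ⟨fun X y hy hy' x hx => ?_, fun y hy => ?_⟩⟩
  · rw [hy.eq_decayingSolution hy' hx, decayingSolution_eq h₁ h₂, h₀]
  · rw [hy.eq_decayingSolution]
    exact ⟨fun x => by rw [decayingSolution_eq h₁ h₂, h₀], decayingSolution_zero,
      abs_decayingSolution_zero_sub_lt⟩
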